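/- Let $G=(A\cup B,E)$ be a finite bipartite graph in which every vertex $v$ has an integer capacity $\mathsf{cap}(v)\ge 1$ and a strict ranking of its neighbors. A matching is a set $M\subseteq E$ with $|M(v)|\le\mathsf{cap}(v)$ for every vertex $v$, where $M(v)=\{u:(u,v)\in M\}$; it is perfect if $|M(v)|=\mathsf{cap}(v)$ for every $v$. For a vertex $v$ with neighbors $u,u'$ let $\mathsf{vote}_v(u,u')$ be $1$ if $v$ prefers $u$ to $u'$, $-1$ if $v$ prefers $u'$ to $u$, and $0$ if $u=u'$. For sets $S,T$ of neighbors of $v$ let $$\mathsf{vote}_v(S,T)=\min_{\psi}\sum_{u\in S\setminus T}\mathsf{vote}_v(u,\psi(u)),$$ where $\psi$ ranges over all bijections from $S\setminus T$ to $T\setminus S$ (if these sets have different sizes, the smaller one is first filled up with dummies that $v$ likes less than all neighbors, and the sum runs over the filled-up set). Let $\Delta(M,N)=\sum_{v\in A\cup B}\mathsf{vote}_v(M(v),N(v))$. A perfect matching $M$ is a popular perfect matching if $\Delta(M,N)\ge 0$ for all perfect matchings $N$ in $G$. The cloned one-to-one instance $G'=(A'\cup B',E')$ has clones $v_1,\dots,v_{\mathsf{cap}(v)}$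 of every vertex $v$, all of capacity $1$, and all edges $(a_i,b_j)$ with $(a,b)\in E$; each $v_i$ ranks its neighbors as $v$ does, with every neighbor $u$ of $v$ replaced by its clones in the order $u_1\succ\cdots\succ u_{\mathsf{cap}(u)}$. A realization of a perfect matching $M$ of $G$ is a matching $M'$ in $G'$ that contains exactly one copy $(a_i,b_j)$ of every edge $(a,b)\in M$ and no other edges. Let $G'_{M'}$ be the subgraph of $G'$ on $A'\cup B'$, with the same preferences, whose edge set is $$E'_{M'}=M'\cup\{(a_i,b_j):(a,b)\in E\setminus M,\ 1\le i\le\mathsf{cap}(a),\ 1\le j\le\mathsf{cap}(b)\}.$$ For an edge $(x,y)$ of $G'_{M'}$ let $\mathsf{wt}_{M'}(x,y)=\mathsf{vote}_x(y,M'(x))+\mathsf{vote}_y(x,M'(y))$, where $M'(z)$ is the partner of $z$ in $M'$, and let $\mathsf{wt}_{M'}(C)$ be the sum of the weights of all edges of a cycle $C$. A cycle is alternating with respect to $M'$ if its edges lie alternately in $M'$ and outside $M'$. Theorem. A perfect matching $M$ of $G$ is a popular perfect matching in $G$ if and only if there is a realization $M'$ of $M$ such that no alternating cycle $C$ with respect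 to $M'$ in $G'_{M'}$ satisfies $\mathsf{wt}_{M'}(C)>0$. -/

import Mathlib

/-- A many-to-many instance on the bipartite vertex set `A ∪ B`: an edge set, a capacity `≥ 1` for
every vertex, and for every vertex a strict ranking of its neighbours. `prefA a b b'` means that
`a` prefers `b` to `b'`; only its values on neighbours of `a` matter (likewise `prefB`). -/
structure MatchingInstance (A B : Type*) where
  E : Finset (A × B)
  capA : A → ℕ
  capB : B → ℕ
  one_le_capA : ∀ a, 1 ≤ capA a
  one_le_capB : ∀ b, 1 ≤ capB b
  prefA : A → B → B → Prop
  prefB : B → A → A → Prop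
  prefA_strict : ∀ a, IsStrictTotalOrder {b : B // (a, b) ∈ E} (fun x y => prefA a x y)
  prefB_strict : ∀ b, IsStrictTotalOrder {a : A // (a, b) ∈ E} (fun x y => prefB b x y)

section Votes

variable {V : Type*}

open Classical in
/-- The vote for `u` versus `u'` of a voter with strict preference relation `r`. -/
noncomputable def vote (r : V → V → Prop) (u u' : V) : ℤ :=
  if r u u' then 1 else if r u' u then -1 else 0

/-- The preference relation `r` extended by dummies (`none`), less preferred than all vertices. -/
def dummyPref (r : V → V → Prop) : Option V → Option V → Prop
  | some u, some u' => r u u'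
  | some _, none => True
  | none, _ => False

variable [DecidableEq V]

/-- `S \ T`, filled up with dummies if it is smaller than `T \ S` (no dummies otherwise, as the
subtraction is truncated). -/
abbrev PaddedDiff (S T : Finset V) : Type _ :=
  {u : V // u ∈ S \ T} ⊕ Fin ((T \ S).card - (S \ T).card)

/-- An element of `PaddedDiff S T` as a vertex or a dummy. -/
def PaddedDiff.val {S T : Finset V} : PaddedDiff S T → Option V :=
  Sum.elim (fun u => some u.1) (fun _ => none)

theorem PaddedDiff.nonempty_equiv (S T : Finset V) :
    Nonempty (PaddedDiff S T ≃ PaddedDiff T S) := by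
  refine ⟨Fintype.equivOfCardEq ?_⟩
  simp only [Fintype.card_sum, Fintype.card_fin, Fintype.card_coe]
  omega

/-- The vote for `S` versus `T`: the minimum, over all bijections `ψ` from `S \ T` to `T \ S`
(padded with dummies), of the number of wins minus the number of losses. -/
noncomputable def voteSet (r : V → V → Prop) (S T : Finset V) : ℤ :=
  (Finset.univ : Finset (PaddedDiff S T ≃ PaddedDiff T S)).inf'
    (Finset.univ_nonempty_iff.mpr (PaddedDiff.nonempty_equiv S T))
    (fun ψ => ∑ x, vote (dummyPref r) x.val (ψ x).val)

end Votes

namespace MatchingInstance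

section Basic

variable {A B : Type*} [DecidableEq A] [DecidableEq B]

/-- `M(a)` for `a ∈ A`. -/
def partnersA [Fintype B] (M : Finset (A × B)) (a : A) : Finset B :=
  Finset.univ.filter (fun b => (a, b) ∈ M)

/-- `M(b)` for `b ∈ B`. -/
def partnersB [Fintype A] (M : Finset (A × B)) (b : B) : Finset A :=
  Finset.univ.filter (fun a => (a, b) ∈ M)

variable [Fintype A] [Fintype B] (G : MatchingInstance A B)

/-- A matching: a set of edges that respects all capacities. -/
def IsMatching (M : Finset (A × B)) : Prop :=
  M ⊆ G.E ∧ (∀ a, (partnersA M a).card ≤ G.capA a) ∧ ∀ b, (partnersB M b).card ≤ G.capB b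

/-- A perfect matching: every vertex is matched up to its capacity. -/
def IsPerfectMatching (M : Finset (A × B)) : Prop :=
  G.IsMatching M ∧ (∀ a, (partnersA M a).card = G.capA a) ∧
    ∀ b, (partnersB M b).card = G.capB b

/-- `Δ(M, N)`: the sum of the votes of all vertices for `M` versus `N`. -/
noncomputable def Delta (M N : Finset (A × B)) : ℤ :=
  ∑ a, voteSet (G.prefA a) (partnersA M a) (partnersA N a) +
    ∑ b, voteSet (G.prefB b) (partnersB M b) (partnersB N b)

/-- A popular perfect matching: a perfect matching that loses to no perfect matching. -/
def IsPopularPerfectMatching (M : Finset (A × B)) : Prop :=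
  G.IsPerfectMatching M ∧ ∀ N, G.IsPerfectMatching N → 0 ≤ G.Delta M N

/-- The weight of the pair `(a, b)` with respect to a perfect matching `M` of a one-to-one
instance: `vote_a(b, M(a)) + vote_b(a, M(b))`. Both sums run over the one partner in `M`. -/
noncomputable def wt (M : Finset (A × B)) (e : A × B) : ℤ :=
  ∑ b' ∈ partnersA M e.1, vote (G.prefA e.1) e.2 b' +
    ∑ a' ∈ partnersB M e.2, vote (G.prefB e.2) e.1 a'

/-- A cycle `a₀ b₀ a₁ b₁ ⋯ a_{k-1} b_{k-1} a₀` in `G` with `k = n + 2 ≥ 2` and `2k` distinct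
vertices, whose edges lie alternately in `M` and outside `M`. The index `i + 1` in `Fin (n + 2)`
is taken modulo `n + 2`. -/
structure AlternatingCycle (M : Finset (A × B)) where
  n : ℕ
  a : Fin (n + 2) → A
  b : Fin (n + 2) → B
  a_injective : Function.Injective a
  b_injective : Function.Injective b
  matched : ∀ i, (a i, b i) ∈ G.E ∧ (a i, b i) ∈ M
  unmatched : ∀ i, (a (i + 1), b i) ∈ G.E ∧ (a (i + 1), b i) ∉ M

/-- The weight `wt_M(C)` of an alternating cycle: the sum of the weights of all its edges. -/
noncomputable def AlternatingCycle.weight {G : MatchingInstance A B} {M : Finset (A × B)}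
    (C : G.AlternatingCycle M) : ℤ :=
  ∑ i, G.wt M (C.a i, C.b i) + ∑ i, G.wt M (C.a (i + 1), C.b i)

end Basic

section Clone

variable {A B : Type*} (G : MatchingInstance A B)

/-- The subinstance whose edges are the edges of `G` that satisfy `P`. -/
def restrict (P : A × B → Prop) [DecidablePred P] : MatchingInstance A B where
  E := G.E.filter P
  capA := G.capA
  capB := G.capB
  one_le_capA := G.one_le_capA
  one_le_capB := G.one_le_capB
  prefA := G.prefA
  prefB := G.prefB
  prefA_strict a := by
    have h := G.prefA_strict a
    let f : {b : B // (a, b) ∈ G.E.filter P} → {b : B // (a, b) ∈ G.E} :=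
      fun b => ⟨b.1, (Finset.mem_filter.mp b.2).1⟩
    exact
      { trichotomous := fun x y h1 h2 => Subtype.ext
          (show (f x).1 = (f y).1 from congrArg _ (h.trichotomous (f x) (f y) h1 h2))
        irrefl := fun x => h.irrefl (f x)
        trans := fun x y z => h.trans (f x) (f y) (f z) }
  prefB_strict b := by
    have h := G.prefB_strict b
    let f : {a : A // (a, b) ∈ G.E.filter P} → {a : A // (a, b) ∈ G.E} :=
      fun a => ⟨a.1, (Finset.mem_filter.mp a.2).1⟩
    exact
      { trichotomous := fun x y h1 h2 => Subtype.ext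
          (show (f x).1 = (f y).1 from congrArg _ (h.trichotomous (f x) (f y) h1 h2))
        irrefl := fun x => h.irrefl (f x)
        trans := fun x y z => h.trans (f x) (f y) (f z) }

/-- The clones `a_i` with `a ∈ A` and `i < cap(a)`. -/
abbrev CloneA : Type _ := Σ a : A, Fin (G.capA a)

/-- The clones `b_j` with `b ∈ B` and `j < cap(b)`. -/
abbrev CloneB : Type _ := Σ b : B, Fin (G.capB b)

/-- The original pair `(a, b)` of a pair of clones `(a_i, b_j)`. -/
def proj (e : G.CloneA × G.CloneB) : A × B := (e.1.1, e.2.1)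

/-- A preference relation on vertices extended to clones: every vertex `u` is replaced by its
clones `u_1 ≻ u_2 ≻ ⋯`. -/
def clonePref {V : Type*} {cap : V → ℕ} (r : V → V → Prop) (x y : Σ u : V, Fin (cap u)) : Prop :=
  r x.1 y.1 ∨ (x.1 = y.1 ∧ x.2.val < y.2.val)

theorem clonePref_strict {V : Type*} {cap : V → ℕ} (r : V → V → Prop) (p : V → Prop)
    (q : (Σ u : V, Fin (cap u)) → Prop) (hq : ∀ x, q x → p x.1)
    (h : IsStrictTotalOrder {u : V // p u} (fun x y => r x y)) :
    IsStrictTotalOrder {x : Σ u : V, Fin (cap u) // q x} (fun x y => clonePref r x.1 y.1) := by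
  have irr : ∀ u, p u → ¬ r u u := fun u hu => h.irrefl ⟨u, hu⟩
  have tr : ∀ u v w, p u → p v → p w → r u v → r v w → r u w := fun u v w hu hv hw =>
    h.trans ⟨u, hu⟩ ⟨v, hv⟩ ⟨w, hw⟩
  have tri : ∀ u v, p u → p v → ¬ r u v → ¬ r v u → u = v := fun u v hu hv h1 h2 =>
    congrArg Subtype.val (h.trichotomous ⟨u, hu⟩ ⟨v, hv⟩ h1 h2)
  refine { trichotomous := ?_, irrefl := ?_, trans := ?_ }
  · rintro ⟨⟨u, i⟩, hx⟩ ⟨⟨v, j⟩, hy⟩ h1 h2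
    simp only [clonePref, not_or, not_and] at h1 h2
    obtain rfl := tri u v (hq _ hx) (hq _ hy) h1.1 h2.1
    obtain rfl : i = j := Fin.ext (le_antisymm (not_lt.mp (h2.2 rfl)) (not_lt.mp (h1.2 rfl)))
    rfl
  · rintro ⟨⟨u, i⟩, hx⟩ (h1 | h1)
    · exact irr u (hq _ hx) h1
    · exact lt_irrefl _ h1.2
  · rintro ⟨⟨u, i⟩, hx⟩ ⟨⟨v, j⟩, hy⟩ ⟨⟨w, k⟩, hz⟩ h1 h2
    simp only [clonePref] at h1 h2 ⊢
    rcases h1 with h1 | ⟨rfl, h1⟩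
    · rcases h2 with h2 | ⟨rfl, h2⟩
      · exact Or.inl (tr u v w (hq _ hx) (hq _ hy) (hq _ hz) h1 h2)
      · exact Or.inl h1
    · rcases h2 with h2 | ⟨rfl, h2⟩
      · exact Or.inl h2
      · exact Or.inr ⟨rfl, h1.trans h2⟩

variable [DecidableEq A] [DecidableEq B] [Fintype A] [Fintype B]

/-- The one-to-one cloned instance `G'`: it has all edges `(a_i, b_j)` with `(a, b) ∈ E`. -/
def clone : MatchingInstance G.CloneA G.CloneB where
  E := Finset.univ.filter (fun e => G.proj e ∈ G.E)
  capA _ := 1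
  capB _ := 1
  one_le_capA _ := le_rfl
  one_le_capB _ := le_rfl
  prefA x := clonePref (G.prefA x.1)
  prefB y := clonePref (G.prefB y.1)
  prefA_strict x := clonePref_strict (G.prefA x.1) (fun b => (x.1, b) ∈ G.E) _
    (fun _ hy => (Finset.mem_filter.mp hy).2) (G.prefA_strict x.1)
  prefB_strict y := clonePref_strict (G.prefB y.1) (fun a => (a, y.1) ∈ G.E) _
    (fun _ hx => (Finset.mem_filter.mp hx).2) (G.prefB_strict y.1)

/-- `M'` is a one-to-one realization of `M`: it consists of exactly one copy `(a_i, b_j)` of every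
edge `(a, b) ∈ M`, and no clone is used twice. -/
def IsRealization (M : Finset (A × B)) (M' : Finset (G.CloneA × G.CloneB)) : Prop :=
  Set.BijOn G.proj M' M ∧ G.clone.IsMatching M'

/-- The subinstance `G'_{M'}` of `G'` for a realization `M'` of `M`: its edges are those of `M'`
and all copies `(a_i, b_j)` of all edges `(a, b) ∈ E \ M`. -/
def cloneSub (M : Finset (A × B)) (M' : Finset (G.CloneA × G.CloneB)) :
    MatchingInstance G.CloneA G.CloneB :=
  G.clone.restrict (fun e => e ∈ M' ∨ G.proj e ∉ M)

end Clone

end MatchingInstance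

/-! Both sides are compared with a condition on `G` and `M` alone: the existence of a rotation
(`IsRotation`), a permutation of edges of `M`, with positive total `gain`. Since this condition
mentions no realization, any realization serves in the forward direction, and one good realization
suffices in the converse.

A positive alternating cycle in a realization projects to a cyclic rotation with gain equal to its
weight, and each cycle of a rotation lifts back (`IsRealization.exists_isRotation`,
`IsRealization.exists_alternatingCycle`). If a perfect matching `N` beats `M`, the optimal
bijections in the votes link the edges of `M \ N` into a rotation of gain `-Δ(M, N)`
(`exists_isRotation_of_Delta_neg`).

The difficulty is the reverse passage, from a positive rotation to a matching `N` with `Δ(M, N) <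
0`: a rotation may create the same new edge twice, through different clones, and then the switched
edges form no matching with the right degrees. `IsRotation.exists_injOn` excludes this for a
positive rotation of minimal support by a parity argument. -/

/-! ### Extracting a positive cycle from a weighted permutation -/

/-- Fixed points contribute zero, so the sum is additive over disjoint cycle factors and one of them
must be positive. -/
theorem Equiv.Perm.exists_isCycle_sum_pos {X : Type*} [Fintype X] [DecidableEq X] (f : X → X → ℤ)
    (hf : ∀ x, f x x = 0) (π : Equiv.Perm X) (h : 0 < ∑ x, f x (π x)) :
    ∃ c : Equiv.Perm X, c.IsCycle ∧ (∀ x, c x = x ∨ c x = π x) ∧ 0 < ∑ x, f x (c x) := by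
  induction π using Equiv.Perm.cycle_induction_on with
  | base_one => simp [hf] at h
  | base_cycles σ hσ => exact ⟨σ, hσ, fun x => Or.inr rfl, h⟩
  | induction_disjoint σ τ hd _ ih₁ ih₂ =>
    have hsum : ∑ x, f x ((σ * τ) x) = ∑ x, f x (σ x) + ∑ x, f x (τ x) := by
      rw [← Finset.sum_add_distrib]
      refine Finset.sum_congr rfl fun x _ => ?_
      rw [Equiv.Perm.mul_apply]
      rcases hd x with hx | hx
      · have : σ (τ x) = τ x := by
          rcases hd (τ x) with h1 | h1
          · exact h1
          · rw [τ.injective h1, hx]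
        rw [this, hx, hf, zero_add]
      · rw [hx, hf, add_zero]
    rw [hsum] at h
    by_cases h1 : 0 < ∑ x, f x (σ x)
    · obtain ⟨c, hc, hcx, hpos⟩ := ih₁ h1
      refine ⟨c, hc, fun x => ?_, hpos⟩
      rcases hcx x with hx | hx
      · exact Or.inl hx
      · rcases hd x with h2 | h2
        · exact Or.inl (hx.trans h2)
        · exact Or.inr (by rw [Equiv.Perm.mul_apply, h2, hx])
    · obtain ⟨c, hc, hcx, hpos⟩ := ih₂ (by omega)
      refine ⟨c, hc, fun x => ?_, hpos⟩
      rcases hcx x with hx | hx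
      · exact Or.inl hx
      · rcases hd (τ x) with h2 | h2
        · exact Or.inr (by rw [Equiv.Perm.mul_apply, h2, hx])
        · exact Or.inl (hx.trans (τ.injective h2))

/-! ### Votes between sets of equal size -/

section Votes

variable {V : Type*}

theorem vote_neg (r : V → V → Prop) {x y : V} (h : r x y → ¬ r y x) :
    vote r x y = - vote r y x := by
  unfold vote
  by_cases h1 : r x y
  · simp [h1, h h1]
  · by_cases h2 : r y x <;> simp [h1, h2]

theorem vote_self (r : V → V → Prop) {x : V} (h : ¬ r x x) : vote r x x = 0 := by
  simp [vote, h]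

theorem vote_clonePref {cap : V → ℕ} (r : V → V → Prop) (x y : Σ u : V, Fin (cap u))
    (h : x.1 ≠ y.1) : vote (MatchingInstance.clonePref r) x y = vote r x.1 y.1 := by
  have h₁ : MatchingInstance.clonePref r x y ↔ r x.1 y.1 := by
    simp [MatchingInstance.clonePref, h]
  have h₂ : MatchingInstance.clonePref r y x ↔ r y.1 x.1 := by
    simp [MatchingInstance.clonePref, h.symm]
  by_cases h3 : r x.1 y.1 <;> by_cases h4 : r y.1 x.1 <;> simp [vote, h₁, h₂, h3, h4]

theorem vote_dummyPref_some (r : V → V → Prop) (x y : V) :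
    vote (dummyPref r) (some x) (some y) = vote r x y := rfl

variable [DecidableEq V]

theorem card_eq_of_bijOn_sdiff {S T : Finset V} {g : V → V}
    (hg : Set.BijOn g (S \ T : Finset V) (T \ S : Finset V)) : S.card = T.card := by
  have h : (S \ T).card = (T \ S).card :=
    Finset.card_bij (fun x _ => g x) (fun x hx => hg.mapsTo hx)
      (fun x hx y hy h => hg.injOn hx hy h) (fun y hy => by
        obtain ⟨x, hx, rfl⟩ := hg.surjOn hy
        exact ⟨x, hx, rfl⟩)
  have h1 := Finset.card_sdiff_add_card_inter S T
  have h2 := Finset.card_sdiff_add_card_inter T S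
  rw [Finset.inter_comm] at h2
  omega

/-- A bijection between the differences forces equal sizes, so there are no dummies and `g` is one
of the candidates in the minimum. -/
theorem voteSet_le (r : V → V → Prop) {S T : Finset V} {g : V → V}
    (hg : Set.BijOn g (S \ T : Finset V) (T \ S : Finset V)) :
    voteSet r S T ≤ ∑ x ∈ S \ T, vote r x (g x) := by
  have hcard : (T \ S).card = (S \ T).card :=
    Finset.card_sdiff_comm (card_eq_of_bijOn_sdiff hg).symm
  have e₁ : IsEmpty (Fin ((T \ S).card - (S \ T).card)) := by rw [hcard, Nat.sub_self]; infer_instance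
  have e₂ : IsEmpty (Fin ((S \ T).card - (T \ S).card)) := by rw [hcard, Nat.sub_self]; infer_instance
  let ψ : PaddedDiff S T ≃ PaddedDiff T S :=
    Equiv.sumCongr (hg.equiv g : {u // u ∈ S \ T} ≃ {u // u ∈ T \ S}) (Equiv.equivOfIsEmpty _ _)
  refine (Finset.inf'_le _ (Finset.mem_univ ψ)).trans (le_of_eq ?_)
  rw [Fintype.sum_sum_type, Finset.univ_eq_empty (α := Fin ((T \ S).card - (S \ T).card)),
    Finset.sum_empty, add_zero, ← Finset.sum_coe_sort (S \ T)]
  exact Finset.sum_congr rfl fun x _ => vote_dummyPref_some r _ _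

theorem exists_voteSet_eq (r : V → V → Prop) {S T : Finset V} (h : S.card = T.card) :
    ∃ g : V → V, Set.BijOn g (S \ T : Finset V) (T \ S : Finset V) ∧
      voteSet r S T = ∑ x ∈ S \ T, vote r x (g x) := by
  have hcard : (T \ S).card = (S \ T).card := Finset.card_sdiff_comm h.symm
  have e₁ : IsEmpty (Fin ((T \ S).card - (S \ T).card)) := by rw [hcard, Nat.sub_self]; infer_instance
  have e₂ : IsEmpty (Fin ((S \ T).card - (T \ S).card)) := by rw [hcard, Nat.sub_self]; infer_instance
  obtain ⟨ψ, -, hψ⟩ := Finset.exists_mem_eq_inf'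
    (Finset.univ_nonempty_iff.mpr (PaddedDiff.nonempty_equiv S T))
    (fun ψ : PaddedDiff S T ≃ PaddedDiff T S => ∑ x, vote (dummyPref r) x.val (ψ x).val)
  let φ : {u // u ∈ S \ T} ≃ {u // u ∈ T \ S} :=
    ((Equiv.sumEmpty _ _).symm.trans ψ).trans (Equiv.sumEmpty _ _)
  have hφ : ∀ x, ψ (Sum.inl x) = Sum.inl (φ x) := fun x =>
    ((Equiv.sumEmpty {u // u ∈ T \ S} (Fin ((S \ T).card - (T \ S).card))).symm_apply_apply _).symm
  have hg : ∀ x (hx : x ∈ S \ T), (if hx : x ∈ S \ T then (φ ⟨x, hx⟩ : V) else x) = φ ⟨x, hx⟩ :=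
    fun x hx => dif_pos hx
  -- The value outside `S \ T` is arbitrary.
  refine ⟨fun x => if hx : x ∈ S \ T then φ ⟨x, hx⟩ else x, ⟨?_, ?_, ?_⟩, ?_⟩
  · intro x hx
    rw [Finset.mem_coe] at hx
    simp only [hg x hx]
    exact (φ ⟨x, hx⟩).2
  · intro x hx y hy hxy
    rw [Finset.mem_coe] at hx hy
    simp only [hg x hx, hg y hy] at hxy
    exact congrArg Subtype.val (φ.injective (Subtype.ext hxy))
  · intro y hy
    refine ⟨φ.symm ⟨y, hy⟩, (φ.symm ⟨y, hy⟩).2, ?_⟩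
    simp only [hg _ (φ.symm ⟨y, hy⟩).2]
    simp
  · unfold voteSet
    rw [hψ, Fintype.sum_sum_type, Finset.univ_eq_empty (α := Fin ((T \ S).card - (S \ T).card)),
      Finset.sum_empty, add_zero, ← Finset.sum_coe_sort (S \ T)]
    refine Finset.sum_congr rfl fun x _ => ?_
    rw [hφ]
    exact (vote_dummyPref_some r _ _).trans (by simp only [hg _ x.2])

end Votes

namespace MatchingInstance

variable {A B : Type*}

/-! ### Rotations and their gain -/

section Preferences

variable (G : MatchingInstance A B)

theorem prefA_irrefl {a : A} {b : B} (h : (a, b) ∈ G.E) : ¬ G.prefA a b b :=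
  (G.prefA_strict a).irrefl ⟨b, h⟩

theorem prefB_irrefl {a : A} {b : B} (h : (a, b) ∈ G.E) : ¬ G.prefB b a a :=
  (G.prefB_strict b).irrefl ⟨a, h⟩

theorem voteA_neg {a : A} {b b' : B} (h : (a, b) ∈ G.E) (h' : (a, b') ∈ G.E) :
    vote (G.prefA a) b b' = - vote (G.prefA a) b' b :=
  vote_neg _ fun h1 h2 => G.prefA_irrefl h ((G.prefA_strict a).trans ⟨b, h⟩ ⟨b', h'⟩ ⟨b, h⟩ h1 h2)

theorem voteB_neg {a a' : A} {b : B} (h : (a, b) ∈ G.E) (h' : (a', b) ∈ G.E) :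
    vote (G.prefB b) a a' = - vote (G.prefB b) a' a :=
  vote_neg _ fun h1 h2 => G.prefB_irrefl h ((G.prefB_strict b).trans ⟨a, h⟩ ⟨a', h'⟩ ⟨a, h⟩ h1 h2)

/-- A permutation of `A × B` that moves only edges of `M`, such that a moved edge `(a, b)` with
image `(a', b')` yields an edge `(a', b)` outside `M`. -/
def IsRotation (M : Finset (A × B)) (π : Equiv.Perm (A × B)) : Prop :=
  ∀ e, π e = e ∨ (e ∈ M ∧ π e ∈ M ∧ ((π e).1, e.2) ∈ G.E ∧ ((π e).1, e.2) ∉ M)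

variable {G}

theorem IsRotation.of_eq_or_eq {M : Finset (A × B)} {π c : Equiv.Perm (A × B)}
    (h : G.IsRotation M π) (hc : ∀ e, c e = e ∨ c e = π e) : G.IsRotation M c := by
  intro e
  rcases hc e with h1 | h1
  · exact Or.inl h1
  · rw [h1]
    exact h e

theorem IsRotation.of_ne {M : Finset (A × B)} {π : Equiv.Perm (A × B)} (h : G.IsRotation M π)
    {e : A × B} (he : π e ≠ e) :
    e ∈ M ∧ π e ∈ M ∧ ((π e).1, e.2) ∈ G.E ∧ ((π e).1, e.2) ∉ M :=
  (h e).resolve_left he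

end Preferences

variable [DecidableEq A] [DecidableEq B]

theorem mem_partnersA [Fintype B] {M : Finset (A × B)} {a : A} {b : B} : b ∈ partnersA M a ↔ (a, b) ∈ M := by
  simp [partnersA]

theorem mem_partnersB [Fintype A] {M : Finset (A × B)} {a : A} {b : B} : a ∈ partnersB M b ↔ (a, b) ∈ M := by
  simp [partnersB]

section Gain

variable (G : MatchingInstance A B)

/-- The vote of `a'` and `b` for the edge `(a', b)` against `(a', b')` and `(a, b)`, where
`e = (a, b)` and `f = (a', b')` are different; `0` if `e = f`. -/
noncomputable def gain (e f : A × B) : ℤ :=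
  if e = f then 0 else vote (G.prefA f.1) e.2 f.2 + vote (G.prefB e.2) f.1 e.1

theorem gain_self (e : A × B) : G.gain e e = 0 := if_pos rfl

theorem gain_of_ne {e f : A × B} (h : e ≠ f) :
    G.gain e f = vote (G.prefA f.1) e.2 f.2 + vote (G.prefB e.2) f.1 e.1 := if_neg h

end Gain

variable [Fintype A] [Fintype B]

/-! ### `Δ(M, N)` as a sum over the edges of `M \ N` -/

theorem sum_partnersA_sdiff (M N : Finset (A × B)) (F : A → B → ℤ) :
    ∑ a, ∑ b ∈ partnersA M a \ partnersA N a, F a b = ∑ e ∈ M \ N, F e.1 e.2 :=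
  (Finset.sum_finset_product (M \ N) Finset.univ (fun a => partnersA M a \ partnersA N a)
    (f := fun e => F e.1 e.2) (fun e => by simp [mem_partnersA])).symm

theorem sum_partnersB_sdiff (M N : Finset (A × B)) (F : B → A → ℤ) :
    ∑ b, ∑ a ∈ partnersB M b \ partnersB N b, F b a = ∑ e ∈ M \ N, F e.2 e.1 :=
  (Finset.sum_finset_product_right (M \ N) Finset.univ (fun b => partnersB M b \ partnersB N b)
    (f := fun e => F e.2 e.1) (fun e => by simp [mem_partnersB])).symm

variable (G : MatchingInstance A B)

theorem Delta_le {M N : Finset (A × B)} {f : A → B → B} {g : B → A → A}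
    (hf : ∀ a, Set.BijOn (f a) (partnersA M a \ partnersA N a : Finset B)
      (partnersA N a \ partnersA M a : Finset B))
    (hg : ∀ b, Set.BijOn (g b) (partnersB M b \ partnersB N b : Finset A)
      (partnersB N b \ partnersB M b : Finset A)) :
    G.Delta M N ≤ ∑ e ∈ M \ N, vote (G.prefA e.1) e.2 (f e.1 e.2) +
      ∑ e ∈ M \ N, vote (G.prefB e.2) e.1 (g e.2 e.1) := by
  rw [← sum_partnersA_sdiff M N (fun a b => vote (G.prefA a) b (f a b)),
    ← sum_partnersB_sdiff M N (fun b a => vote (G.prefB b) a (g b a))]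
  exact add_le_add (Finset.sum_le_sum fun a _ => voteSet_le _ (hf a))
    (Finset.sum_le_sum fun b _ => voteSet_le _ (hg b))

theorem exists_Delta_eq {M N : Finset (A × B)}
    (hA : ∀ a, (partnersA M a).card = (partnersA N a).card)
    (hB : ∀ b, (partnersB M b).card = (partnersB N b).card) :
    ∃ (f : A → B → B) (g : B → A → A),
      (∀ a, Set.BijOn (f a) (partnersA M a \ partnersA N a : Finset B)
        (partnersA N a \ partnersA M a : Finset B)) ∧
      (∀ b, Set.BijOn (g b) (partnersB M b \ partnersB N b : Finset A)
        (partnersB N b \ partnersB M b : Finset A)) ∧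
      G.Delta M N = ∑ e ∈ M \ N, vote (G.prefA e.1) e.2 (f e.1 e.2) +
        ∑ e ∈ M \ N, vote (G.prefB e.2) e.1 (g e.2 e.1) := by
  choose f hf hf' using fun a => exists_voteSet_eq (G.prefA a) (hA a)
  choose g hg hg' using fun b => exists_voteSet_eq (G.prefB b) (hB b)
  refine ⟨f, g, hf, hg, ?_⟩
  rw [← sum_partnersA_sdiff M N (fun a b => vote (G.prefA a) b (f a b)),
    ← sum_partnersB_sdiff M N (fun b a => vote (G.prefB b) a (g b a))]
  simp only [Delta, hf', hg']

variable {G}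

/-! ### From a positive rotation to a better perfect matching -/

/-- Take a positive rotation of minimal support; it is a single cycle. If two moved edges produced
the same new edge, exchanging their images would give another rotation with the same support and
gain, hence again a single cycle. But a transposition flips the sign, while cycles with equal
support have equal sign. -/
theorem IsRotation.exists_injOn {M : Finset (A × B)} {π : Equiv.Perm (A × B)}
    (h : G.IsRotation M π) (hpos : 0 < ∑ e, G.gain e (π e)) :
    ∃ ρ : Equiv.Perm (A × B), G.IsRotation M ρ ∧ 0 < ∑ e, G.gain e (ρ e) ∧
      Set.InjOn (fun e => ((ρ e).1, e.2)) (ρ.support : Set (A × B)) := by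
  obtain ⟨ρ, ⟨hρ, hρpos⟩, hmin⟩ := Set.exists_min_image
    {σ : Equiv.Perm (A × B) | G.IsRotation M σ ∧ 0 < ∑ e, G.gain e (σ e)}
    (fun σ => σ.support.card) (Set.toFinite _) ⟨π, h, hpos⟩
  -- A positive cycle factor of `σ` is itself a positive rotation, so by minimality it already has
  -- the full support of `σ`.
  have key : ∀ σ : Equiv.Perm (A × B), G.IsRotation M σ → 0 < ∑ e, G.gain e (σ e) →
      σ.support.card ≤ ρ.support.card → σ.IsCycle := by
    intro σ hσ hσpos hle
    obtain ⟨c, hc, hcσ, hcpos⟩ := Equiv.Perm.exists_isCycle_sum_pos G.gain G.gain_self σ hσpos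
    have hsub : c.support ⊆ σ.support := by
      intro e he
      rw [Equiv.Perm.mem_support] at he ⊢
      rwa [(hcσ e).resolve_left he] at he
    have heq := Finset.eq_of_subset_of_card_le hsub
      (hle.trans (hmin c ⟨hσ.of_eq_or_eq hcσ, hcpos⟩))
    have : c = σ := by
      ext1 e
      by_cases he : c e = e
      · have h1 : e ∉ σ.support := heq ▸ Equiv.Perm.notMem_support.mpr he
        rw [he, Equiv.Perm.notMem_support.mp h1]
      · exact (hcσ e).resolve_left he
    exact this ▸ hc
  refine ⟨ρ, hρ, hρpos, ?_⟩
  intro e₁ he₁ e₂ he₂ heq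
  by_contra hne
  rw [Finset.mem_coe, Equiv.Perm.mem_support] at he₁ he₂
  obtain ⟨ha, hb⟩ := Prod.ext_iff.mp heq
  simp only at ha hb
  obtain ⟨h1M, h1M', h1E, h1N⟩ := hρ.of_ne he₁
  obtain ⟨h2M, h2M', h2E, h2N⟩ := hρ.of_ne he₂
  set σ := ρ * Equiv.swap e₁ e₂ with hσdef
  have hσ1 : σ e₁ = ρ e₂ := by simp [hσdef]
  have hσ2 : σ e₂ = ρ e₁ := by simp [hσdef]
  have hσ3 : ∀ e, e ≠ e₁ → e ≠ e₂ → σ e = ρ e := fun e h1 h2 => by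
    simp [hσdef, Equiv.swap_apply_of_ne_of_ne h1 h2]
  -- Otherwise the common new edge would be `e₁`, which lies in `M`.
  have hn1 : ρ e₂ ≠ e₁ := fun h => h1N (by rw [ha, h]; exact h1M)
  have hn2 : ρ e₁ ≠ e₂ := fun h => h2N (by rw [← ha, h]; exact h2M)
  have hσ : G.IsRotation M σ := by
    intro e
    by_cases h1 : e = e₁
    · subst h1
      rw [hσ1, ← ha]
      exact Or.inr ⟨h1M, h2M', h1E, h1N⟩
    · by_cases h2 : e = e₂
      · subst h2
        rw [hσ2, ha]
        exact Or.inr ⟨h2M, h1M', h2E, h2N⟩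
      · rw [hσ3 e h1 h2]
        exact hρ e
  have hsupp : σ.support = ρ.support := by
    ext e
    rw [Equiv.Perm.mem_support, Equiv.Perm.mem_support]
    by_cases h1 : e = e₁
    · subst h1
      simp [hσ1, hn1, he₁]
    · by_cases h2 : e = e₂
      · subst h2
        simp [hσ2, hn2, he₂]
      · rw [hσ3 e h1 h2]
  -- The edges `e₁`, `e₂` share their `B`-end and their images share the `A`-end, so the exchange
  -- only regroups the same four votes.
  have hsum : ∑ e, G.gain e (σ e) = ∑ e, G.gain e (ρ e) := by
    rw [← sub_eq_zero, ← Finset.sum_sub_distrib, Fintype.sum_eq_add e₁ e₂ hne]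
    · rw [hσ1, hσ2, G.gain_of_ne hn1.symm, G.gain_of_ne hn2.symm, G.gain_of_ne he₁.symm,
        G.gain_of_ne he₂.symm, ha, hb]
      ring
    · rintro e ⟨h1, h2⟩
      rw [hσ3 e h1 h2, sub_self]
  have hs1 := (key ρ hρ hρpos le_rfl).sign
  have hs2 := (key σ hσ (hsum ▸ hρpos) (by rw [hsupp])).sign
  rw [hσdef, Equiv.Perm.sign_mul, Equiv.Perm.sign_swap hne, ← hσdef, hsupp, hs1] at hs2
  revert hs2
  rcases neg_one_pow_eq_or ℤˣ ρ.support.card with h | h <;> rw [h] <;> decide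

/-- Replace every moved edge by the new edge it produces. Since distinct moved edges produce
distinct new ones, the rotation pairs lost and gained partners bijectively at every vertex: degrees
are preserved, and each vote, being a minimum, is at most its value for this pairing. -/
theorem IsRotation.exists_Delta_neg {M : Finset (A × B)} (hM : G.IsPerfectMatching M)
    {π : Equiv.Perm (A × B)} (h : G.IsRotation M π) (hpos : 0 < ∑ e, G.gain e (π e)) :
    ∃ N, G.IsPerfectMatching N ∧ G.Delta M N < 0 := by
  obtain ⟨ρ, hρ, hρpos, hinj⟩ := h.exists_injOn hpos
  set D := ρ.support with hD
  have hDρ : ∀ {e}, e ∈ D → ρ e ∈ D := fun {e} he => Equiv.Perm.apply_mem_support.mpr he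
  have hDρ' : ∀ {e}, e ∈ D → ρ⁻¹ e ∈ D := fun {e} he => by
    rw [hD, ← Equiv.Perm.apply_mem_support]
    rwa [show ρ (ρ⁻¹ e) = e from ρ.apply_symm_apply e]
  have hval : ∀ {e}, e ∈ D → e ∈ M ∧ ρ e ∈ M ∧ ((ρ e).1, e.2) ∈ G.E ∧ ((ρ e).1, e.2) ∉ M :=
    fun {e} he => hρ.of_ne (Equiv.Perm.mem_support.mp he)
  set φ : A × B → A × B := fun e => ((ρ e).1, e.2) with hφ
  set N := (M \ D) ∪ D.image φ with hN
  have hMN : ∀ e, e ∈ M ∧ e ∉ N ↔ e ∈ D := by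
    intro e
    simp only [hN, Finset.mem_union, Finset.mem_sdiff, Finset.mem_image, not_or, not_and, not_not,
      not_exists]
    constructor
    · rintro ⟨h1, h2, -⟩
      exact h2 h1
    · intro he
      exact ⟨(hval he).1, fun _ => he, fun x hx hxe => (hval hx).2.2.2
        (show φ x ∈ M from hxe.symm ▸ (hval he).1)⟩
  have hNM : ∀ e, e ∈ N ∧ e ∉ M ↔ ∃ x ∈ D, φ x = e := by
    intro e
    simp only [hN, Finset.mem_union, Finset.mem_sdiff, Finset.mem_image]
    constructor
    · rintro ⟨h1 | h1, h2⟩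
      · exact absurd h1.1 h2
      · exact h1
    · rintro ⟨x, hx, rfl⟩
      exact ⟨Or.inr ⟨x, hx, rfl⟩, (hval hx).2.2.2⟩
  -- The new edge at `a` paired with `(a, b)` comes from the moved edge whose image is `(a, b)`,
  -- hence the inverse; at the `B`-end the pairing uses `ρ` itself.
  have hf : ∀ a, Set.BijOn (fun b => (ρ⁻¹ (a, b)).2) (partnersA M a \ partnersA N a : Finset B)
      (partnersA N a \ partnersA M a : Finset B) := by
    intro a
    have hφa : ∀ b, φ (ρ⁻¹ (a, b)) = (a, (ρ⁻¹ (a, b)).2) := fun b => by simp [hφ]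
    refine ⟨fun b hb => ?_, fun b hb b' hb' hbb => ?_, fun b hb => ?_⟩
    · simp only [Finset.mem_coe, Finset.mem_sdiff, mem_partnersA, hMN, hNM] at hb ⊢
      exact ⟨_, hDρ' hb, hφa b⟩
    · simp only [Finset.mem_coe, Finset.mem_sdiff, mem_partnersA, hMN] at hb hb' hbb
      have := hinj (hDρ' hb) (hDρ' hb') (show φ _ = φ _ by rw [hφa, hφa, hbb])
      exact (Prod.ext_iff.mp (ρ⁻¹.injective this)).2
    · simp only [Finset.mem_coe, Finset.mem_sdiff, mem_partnersA, hNM] at hb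
      obtain ⟨x, hx, hxe⟩ := hb
      obtain ⟨h1, h2⟩ := Prod.ext_iff.mp hxe
      have hρx : ρ x = (a, (ρ x).2) := Prod.ext h1 rfl
      refine ⟨(ρ x).2, ?_, ?_⟩
      · simp only [Finset.mem_coe, Finset.mem_sdiff, mem_partnersA, hMN]
        rw [← hρx]
        exact hDρ hx
      · simp only
        rw [← hρx]
        simpa using h2
  have hg : ∀ b, Set.BijOn (fun a => (ρ (a, b)).1) (partnersB M b \ partnersB N b : Finset A)
      (partnersB N b \ partnersB M b : Finset A) := by
    intro b
    refine ⟨fun a ha => ?_, fun a ha a' ha' haa => ?_, fun a ha => ?_⟩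
    · simp only [Finset.mem_coe, Finset.mem_sdiff, mem_partnersB, hMN, hNM] at ha ⊢
      exact ⟨_, ha, rfl⟩
    · simp only [Finset.mem_coe, Finset.mem_sdiff, mem_partnersB, hMN] at ha ha' haa
      have := hinj ha ha' (Prod.ext haa rfl)
      exact (Prod.ext_iff.mp this).1
    · simp only [Finset.mem_coe, Finset.mem_sdiff, mem_partnersB, hNM] at ha
      obtain ⟨⟨x, y⟩, hx, hxe⟩ := ha
      obtain ⟨h1, h2⟩ := Prod.ext_iff.mp hxe
      obtain rfl : y = b := h2
      refine ⟨x, ?_, h1⟩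
      simp only [Finset.mem_coe, Finset.mem_sdiff, mem_partnersB, hMN]
      exact hx
  have hcA : ∀ a, (partnersA N a).card = G.capA a := fun a =>
    (card_eq_of_bijOn_sdiff (hf a)).symm.trans (hM.2.1 a)
  have hcB : ∀ b, (partnersB N b).card = G.capB b := fun b =>
    (card_eq_of_bijOn_sdiff (hg b)).symm.trans (hM.2.2 b)
  refine ⟨N, ⟨⟨?_, fun a => (hcA a).le, fun b => (hcB b).le⟩, hcA, hcB⟩, ?_⟩
  · intro e he
    by_cases heM : e ∈ M
    · exact hM.1.1 heM
    · obtain ⟨x, hx, rfl⟩ := (hNM e).mp ⟨he, heM⟩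
      exact (hval hx).2.2.1
  · have hE : M \ N = D := by
      ext e
      rw [Finset.mem_sdiff, hMN]
    refine lt_of_le_of_lt (G.Delta_le hf hg) ?_
    have hsum : ∑ e ∈ D, vote (G.prefA e.1) e.2 (ρ⁻¹ (e.1, e.2)).2 =
        ∑ e ∈ D, vote (G.prefA (ρ e).1) (ρ e).2 e.2 :=
      Finset.sum_bij' (fun e _ => ρ⁻¹ e) (fun e _ => ρ e) (fun e he => hDρ' he)
        (fun e he => hDρ he) (by simp) (by simp) (by simp)
    -- Gains compare new with old and `Δ(M, N)` old with new, so antisymmetry of the votes reverses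
    -- the sign.
    have hgain : ∑ e, G.gain e (ρ e) =
        - (∑ e ∈ D, vote (G.prefA (ρ e).1) (ρ e).2 e.2 +
          ∑ e ∈ D, vote (G.prefB e.2) e.1 (ρ (e.1, e.2)).1) := by
      rw [← Finset.sum_add_distrib, ← Finset.sum_neg_distrib,
        ← Finset.sum_subset (Finset.subset_univ D)]
      · refine Finset.sum_congr rfl fun e he => ?_
        obtain ⟨h1, h2, h3, -⟩ := hval he
        rw [G.gain_of_ne (Equiv.Perm.mem_support.mp he).symm, G.voteA_neg (b' := (ρ e).2) h3 (hM.1.1 h2),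
          G.voteB_neg (a' := e.1) h3 (hM.1.1 h1)]
        ring
      · intro e _ he
        rw [Equiv.Perm.notMem_support.mp he, G.gain_self]
    rw [hE, hsum]
    linarith

/-! ### From a better perfect matching to a positive rotation -/

theorem exists_isRotation_of_Delta_neg {M N : Finset (A × B)} (hM : G.IsPerfectMatching M)
    (hN : G.IsPerfectMatching N) (h : G.Delta M N < 0) :
    ∃ π : Equiv.Perm (A × B), G.IsRotation M π ∧ 0 < ∑ e, G.gain e (π e) := by
  obtain ⟨f, g, hf, hg, hfg⟩ := G.exists_Delta_eq
    (fun a => (hM.2.1 a).trans (hN.2.1 a).symm) (fun b => (hM.2.2 b).trans (hN.2.2 b).symm)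
  have hα : Set.BijOn (fun e : A × B => (g e.2 e.1, e.2)) (M \ N : Finset (A × B))
      (N \ M : Finset (A × B)) := by
    refine ⟨fun e he => ?_, fun e he e' he' hee => ?_, fun e he => ?_⟩
    · have := (hg e.2).mapsTo (x := e.1) (by simpa [mem_partnersB] using he)
      simpa [mem_partnersB] using this
    · obtain ⟨a, b⟩ := e
      obtain ⟨a', b'⟩ := e'
      obtain ⟨h1, h2⟩ := Prod.ext_iff.mp hee
      obtain rfl : b = b' := h2
      exact Prod.ext ((hg b).injOn (by simpa [mem_partnersB] using he)
        (by simpa [mem_partnersB] using he') h1) rfl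
    · obtain ⟨a, ha, hae⟩ := (hg e.2).surjOn (a := e.1) (by simpa [mem_partnersB] using he)
      exact ⟨(a, e.2), by simpa [mem_partnersB] using ha, Prod.ext hae rfl⟩
  have hβ : Set.BijOn (fun e : A × B => (e.1, f e.1 e.2)) (M \ N : Finset (A × B))
      (N \ M : Finset (A × B)) := by
    refine ⟨fun e he => ?_, fun e he e' he' hee => ?_, fun e he => ?_⟩
    · have := (hf e.1).mapsTo (x := e.2) (by simpa [mem_partnersA] using he)
      simpa [mem_partnersA] using this
    · obtain ⟨a, b⟩ := e
      obtain ⟨a', b'⟩ := e'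
      obtain ⟨h1, h2⟩ := Prod.ext_iff.mp hee
      obtain rfl : a = a' := h1
      exact Prod.ext rfl ((hf a).injOn (by simpa [mem_partnersA] using he)
        (by simpa [mem_partnersA] using he') h2)
    · obtain ⟨b, hb, hbe⟩ := (hf e.1).surjOn (a := e.2) (by simpa [mem_partnersA] using he)
      exact ⟨(e.1, b), by simpa [mem_partnersA] using hb, Prod.ext rfl hbe⟩
  -- From an edge of `M \ N`, pass to the edge of `N \ M` paired with it at the `B`-end, then to the
  -- edge of `M \ N` paired with that one at its `A`-end.
  let π₀ : Equiv.Perm {e // e ∈ M \ N} := (hα.equiv _).trans (hβ.equiv _).symm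
  have hπ₀ : ∀ e, ((π₀ e).1.1, f (π₀ e).1.1 (π₀ e).1.2) = (g e.1.2 e.1.1, e.1.2) := fun e =>
    congrArg Subtype.val ((hβ.equiv _).apply_symm_apply ((hα.equiv _) e))
  have hval : ∀ e : {e // e ∈ M \ N}, ((π₀ e).1.1, e.1.2) ∈ N \ M := fun e => by
    have h1 := hα.mapsTo e.2
    rw [show (π₀ e).1.1 = g e.1.2 e.1.1 from (Prod.ext_iff.mp (hπ₀ e)).1]
    exact h1
  have hπ : ∀ e : {e // e ∈ M \ N}, Equiv.Perm.ofSubtype π₀ e.1 = π₀ e := fun e =>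
    Equiv.Perm.ofSubtype_apply_coe π₀ e
  have hπ' : ∀ e, e ∉ M \ N → Equiv.Perm.ofSubtype π₀ e = e := fun e he =>
    Equiv.Perm.ofSubtype_apply_of_not_mem π₀ he
  refine ⟨Equiv.Perm.ofSubtype π₀, fun e => ?_, ?_⟩
  · by_cases he : e ∈ M \ N
    · have h1 := Finset.mem_sdiff.mp (hval ⟨e, he⟩)
      rw [hπ ⟨e, he⟩]
      exact Or.inr ⟨(Finset.mem_sdiff.mp he).1, (Finset.mem_sdiff.mp (π₀ ⟨e, he⟩).2).1,
        hN.1.1 h1.1, h1.2⟩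
    · exact Or.inl (hπ' e he)
  · have hsum : ∑ e ∈ M \ N, vote (G.prefA e.1) e.2 (f e.1 e.2) =
        ∑ e : {e // e ∈ M \ N}, vote (G.prefA (π₀ e).1.1) (π₀ e).1.2 e.1.2 := by
      rw [← Finset.sum_coe_sort (M \ N), ← Equiv.sum_comp π₀]
      refine Finset.sum_congr rfl fun e _ => ?_
      rw [show f (π₀ e).1.1 (π₀ e).1.2 = e.1.2 from (Prod.ext_iff.mp (hπ₀ e)).2]
    have hgain : ∑ e, G.gain e (Equiv.Perm.ofSubtype π₀ e) = - G.Delta M N := by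
      rw [hfg, hsum, ← Finset.sum_coe_sort (M \ N) (fun e => vote (G.prefB e.2) e.1 (g e.2 e.1)),
        ← Finset.sum_add_distrib, ← Finset.sum_neg_distrib,
        ← Finset.sum_subset (Finset.subset_univ (M \ N)), ← Finset.sum_coe_sort (M \ N)]
      · refine Finset.sum_congr rfl fun e _ => ?_
        have h1 := Finset.mem_sdiff.mp (hval e)
        have h2 := (Finset.mem_sdiff.mp e.2).1
        have h3 := (Finset.mem_sdiff.mp (π₀ e).2).1
        rw [hπ, G.gain_of_ne (fun h => h1.2 (by rw [← h]; exact h2)),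
          G.voteA_neg (hN.1.1 h1.1) (hM.1.1 h3), G.voteB_neg (hN.1.1 h1.1) (hM.1.1 h2),
          show (π₀ e).1.1 = g e.1.2 e.1.1 from (Prod.ext_iff.mp (hπ₀ e)).1]
        ring
      · intro e _ he
        rw [hπ' e he, G.gain_self]
    rw [hgain]
    linarith

/-! ### Alternating cycles in a realization as cyclic rotations -/

theorem IsMatching.snd_eq {G : MatchingInstance A B} {M : Finset (A × B)} (h : G.IsMatching M)
    {a : A} {b b' : B} (ha : G.capA a = 1) (hb : (a, b) ∈ M) (hb' : (a, b') ∈ M) : b = b' :=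
  Finset.card_le_one.mp ((h.2.1 a).trans ha.le) b (mem_partnersA.mpr hb) b' (mem_partnersA.mpr hb')

theorem IsMatching.fst_eq {G : MatchingInstance A B} {M : Finset (A × B)} (h : G.IsMatching M)
    {a a' : A} {b : B} (hb : G.capB b = 1) (ha : (a, b) ∈ M) (ha' : (a', b) ∈ M) : a = a' :=
  Finset.card_le_one.mp ((h.2.2 b).trans hb.le) a (mem_partnersB.mpr ha) a' (mem_partnersB.mpr ha')

theorem wt_eq {G : MatchingInstance A B} {M : Finset (A × B)} (h : G.IsMatching M) {a a' : A}
    {b b' : B} (hA : G.capA a = 1) (hB : G.capB b = 1) (ha : (a, b') ∈ M) (hb : (a', b) ∈ M) :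
    G.wt M (a, b) = vote (G.prefA a) b b' + vote (G.prefB b) a a' := by
  have h1 : partnersA M a = {b'} := by
    ext y
    rw [mem_partnersA, Finset.mem_singleton]
    exact ⟨fun hy => h.snd_eq hA hy ha, fun hy => hy ▸ ha⟩
  have h2 : partnersB M b = {a'} := by
    ext x
    rw [mem_partnersB, Finset.mem_singleton]
    exact ⟨fun hx => h.fst_eq hB hx hb, fun hx => hx ▸ hb⟩
  simp only [wt, h1, h2, Finset.sum_singleton]

variable {G : MatchingInstance A B} {M : Finset (A × B)} {M' : Finset (G.CloneA × G.CloneB)}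

theorem mem_clone_E {e : G.CloneA × G.CloneB} : e ∈ G.clone.E ↔ G.proj e ∈ G.E := by
  simp [clone]

theorem mem_cloneSub_E {e : G.CloneA × G.CloneB} :
    e ∈ (G.cloneSub M M').E ↔ G.proj e ∈ G.E ∧ (e ∈ M' ∨ G.proj e ∉ M) := by
  rw [cloneSub, restrict, Finset.mem_filter, mem_clone_E]

theorem IsRealization.isMatching_cloneSub (h : G.IsRealization M M') :
    (G.cloneSub M M').IsMatching M' :=
  ⟨fun _ he => mem_cloneSub_E.mpr ⟨mem_clone_E.mp (h.2.1 he), Or.inl he⟩, h.2.2⟩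

/-- Matching edges weigh zero. Every other edge of `G.cloneSub M M'` copies an edge outside `M`, so
both its ends compare clones of different vertices and the order among clones of one vertex plays no
role. -/
theorem IsRealization.weight_eq (h : G.IsRealization M M')
    (C : (G.cloneSub M M').AlternatingCycle M') :
    C.weight = ∑ i, G.gain (G.proj (C.a i, C.b i)) (G.proj (C.a (i + 1), C.b (i + 1))) := by
  have hM' := h.isMatching_cloneSub
  have h1 : ∀ i, (G.cloneSub M M').wt M' (C.a i, C.b i) = 0 := fun i => by
    have hi := (C.matched i).2
    rw [wt_eq hM' rfl rfl hi hi, vote_self _ ((G.cloneSub M M').prefA_irrefl (C.matched i).1),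
      vote_self _ ((G.cloneSub M M').prefB_irrefl (C.matched i).1), add_zero]
  have h2 : ∀ i, (G.cloneSub M M').wt M' (C.a (i + 1), C.b i) =
      G.gain (G.proj (C.a i, C.b i)) (G.proj (C.a (i + 1), C.b (i + 1))) := fun i => by
    have hi := (C.matched i).2
    have hj := (C.matched (i + 1)).2
    have hn : G.proj (C.a (i + 1), C.b i) ∉ M :=
      (mem_cloneSub_E.mp (C.unmatched i).1).2.resolve_left (C.unmatched i).2
    have hA : (C.b i).1 ≠ (C.b (i + 1)).1 := fun heq => hn (by
      have := h.1.mapsTo hj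
      simp only [proj, Finset.mem_coe, ← heq] at this ⊢
      exact this)
    have hB : (C.a (i + 1)).1 ≠ (C.a i).1 := fun heq => hn (by
      have := h.1.mapsTo hi
      simp only [proj, Finset.mem_coe, ← heq] at this ⊢
      exact this)
    rw [wt_eq hM' rfl rfl hj hi, G.gain_of_ne fun heq => hA (Prod.ext_iff.mp heq).2]
    exact congrArg₂ (· + ·) (vote_clonePref _ _ _ hA) (vote_clonePref _ _ _ hB)
  simp only [AlternatingCycle.weight, h1, h2, Finset.sum_const_zero, zero_add]

theorem IsRealization.exists_isRotation (h : G.IsRealization M M')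
    {C : (G.cloneSub M M').AlternatingCycle M'} (hC : 0 < C.weight) :
    ∃ π : Equiv.Perm (A × B), G.IsRotation M π ∧ 0 < ∑ e, G.gain e (π e) := by
  have hinj : Function.Injective fun i => G.proj (C.a i, C.b i) := fun i j hij =>
    C.a_injective (Prod.ext_iff.mp (h.1.injOn (C.matched i).2 (C.matched j).2 hij)).1
  let ε : Fin (C.n + 2) ↪ A × B := ⟨fun i => G.proj (C.a i, C.b i), hinj⟩
  have happ : ∀ i, (finRotate (C.n + 2)).viaFintypeEmbedding ε (ε i) = ε (i + 1) := fun i => by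
    rw [Equiv.Perm.viaFintypeEmbedding_apply_image, finRotate_apply]
  -- The cyclic shift along the projected matching edges, extended by the identity.
  refine ⟨(finRotate (C.n + 2)).viaFintypeEmbedding ε, fun e => ?_, ?_⟩
  · by_cases he : e ∈ Set.range ε
    · obtain ⟨i, rfl⟩ := he
      rw [happ]
      have hu := mem_cloneSub_E.mp (C.unmatched i).1
      exact Or.inr ⟨h.1.mapsTo (C.matched i).2, h.1.mapsTo (C.matched (i + 1)).2, hu.1,
        hu.2.resolve_left (C.unmatched i).2⟩
    · exact Or.inl (Equiv.Perm.viaFintypeEmbedding_apply_notMem_range _ _ he)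
  · rw [h.weight_eq C] at hC
    refine hC.trans_eq (Fintype.sum_of_injective ε ε.injective _ _ (fun e he => ?_) fun i => ?_)
    · rw [Equiv.Perm.viaFintypeEmbedding_apply_notMem_range _ _ he, G.gain_self]
    · rw [happ]
      rfl

theorem IsRealization.exists_alternatingCycle (h : G.IsRealization M M')
    {π : Equiv.Perm (A × B)} (hπ : G.IsRotation M π) (hpos : 0 < ∑ e, G.gain e (π e)) :
    ∃ C : (G.cloneSub M M').AlternatingCycle M', 0 < C.weight := by
  obtain ⟨c, hc, hcπ, hcpos⟩ := Equiv.Perm.exists_isCycle_sum_pos G.gain G.gain_self π hpos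
  have hrot := hπ.of_eq_or_eq hcπ
  obtain ⟨x, hx, hxc⟩ := id hc
  have hord := hc.orderOf
  -- A cycle moves at least two points, which gives the `n + 2` required by `AlternatingCycle`.
  obtain ⟨n, hn⟩ : ∃ n, orderOf c = n + 2 :=
    ⟨orderOf c - 2, by have := hc.two_le_card_support; omega⟩
  let ε : Fin (n + 2) → A × B := fun i => (c ^ (i : ℕ)) x
  have hmoved : ∀ i, c (ε i) ≠ ε i := fun i => by
    have : (c ^ (i : ℕ)) x ∈ c.support :=
      Equiv.Perm.pow_apply_mem_support.mpr (Equiv.Perm.mem_support.mpr hx)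
    exact Equiv.Perm.mem_support.mp this
  have hsucc : ∀ i, ε (i + 1) = c (ε i) := fun i => by
    -- The wrap-around of `i + 1` is harmless because exponents of `c` only matter modulo its order.
    have h1 : ((i + 1 : Fin (n + 2)) : ℕ) = ((i : ℕ) + 1) % orderOf c := by
      rw [hn, Fin.val_add]
      simp
    simp only [ε]
    rw [h1, pow_mod_orderOf, pow_succ', Equiv.Perm.mul_apply]
  have hinj : Function.Injective ε := fun i j hij => by
    -- Powers of a cycle that agree at one moved point are equal.
    have : c ^ (i : ℕ) = c ^ (j : ℕ) := hc.pow_eq_pow_iff.mpr ⟨x, hx, hij⟩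
    exact Fin.ext (pow_injOn_Iio_orderOf (by simp [hn]) (by simp [hn]) this)
  have hsurj : ∀ e, e ∉ Set.range ε → c e = e := fun e he => by
    by_contra hce
    obtain ⟨k, rfl⟩ := hc.exists_pow_eq hx hce
    refine he ⟨⟨k % orderOf c, hn ▸ Nat.mod_lt _ (by omega)⟩, ?_⟩
    simp only [ε]
    rw [pow_mod_orderOf]
  have hval := fun i => hrot.of_ne (hmoved i)
  choose ℓ hℓ hℓε using fun i => h.1.surjOn (hval i).1
  have hℓinj : ∀ {i j}, ℓ i = ℓ j → i = j := fun {i j} hij => hinj (by rw [← hℓε, hij, hℓε])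
  let C : (G.cloneSub M M').AlternatingCycle M' :=
    { n := n
      a := fun i => (ℓ i).1
      b := fun i => (ℓ i).2
      a_injective := fun i j (hij : (ℓ i).1 = (ℓ j).1) => hℓinj <| Prod.ext hij <|
        h.2.snd_eq rfl (a := (ℓ i).1) (hℓ i) (by rw [hij]; exact hℓ j)
      b_injective := fun i j (hij : (ℓ i).2 = (ℓ j).2) => hℓinj <| Prod.ext
        (h.2.fst_eq rfl (b := (ℓ i).2) (hℓ i) (by rw [hij]; exact hℓ j)) hij
      matched := fun i => ⟨h.isMatching_cloneSub.1 (hℓ i), hℓ i⟩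
      unmatched := fun i => by
        have h1 : G.proj ((ℓ (i + 1)).1, (ℓ i).2) = ((c (ε i)).1, (ε i).2) := by
          rw [← hsucc, ← hℓε, ← hℓε]
          rfl
        have h2 := hval i
        exact ⟨mem_cloneSub_E.mpr ⟨h1 ▸ h2.2.2.1, Or.inr (h1 ▸ h2.2.2.2)⟩,
          fun hmem => h2.2.2.2 (h1 ▸ h.1.mapsTo hmem)⟩ }
  refine ⟨C, ?_⟩
  rw [h.weight_eq C]
  refine hcpos.trans_eq (Fintype.sum_of_injective ε hinj _ _ (fun e he => ?_) fun i => ?_).symm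
  · rw [hsurj e he, G.gain_self]
  · rw [← hsucc, ← hℓε, ← hℓε]

/-! ### Existence of realizations and the theorem -/

/-- By the capacity bounds each vertex can assign different clones of itself to its partners; the
choices at the two ends of an edge are independent. -/
theorem exists_isRealization (hM : G.IsMatching M) : ∃ M', G.IsRealization M M' := by
  have hA : ∀ a, Nonempty (partnersA M a ↪ Fin (G.capA a)) := fun a =>
    Function.Embedding.nonempty_of_card_le (by simpa using hM.2.1 a)
  have hB : ∀ b, Nonempty (partnersB M b ↪ Fin (G.capB b)) := fun b =>
    Function.Embedding.nonempty_of_card_le (by simpa using hM.2.2 b)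
  let σ : ∀ a, partnersA M a ↪ Fin (G.capA a) := fun a => (hA a).some
  let τ : ∀ b, partnersB M b ↪ Fin (G.capB b) := fun b => (hB b).some
  let lift : {e // e ∈ M} → G.CloneA × G.CloneB := fun e =>
    (⟨e.1.1, σ e.1.1 ⟨e.1.2, mem_partnersA.mpr e.2⟩⟩,
      ⟨e.1.2, τ e.1.2 ⟨e.1.1, mem_partnersB.mpr e.2⟩⟩)
  have hlift : ∀ e, G.proj (lift e) = e.1 := fun e => rfl
  have hfst : ∀ e f, (lift e).1 = (lift f).1 → e = f := by
    rintro ⟨⟨a, b⟩, he⟩ ⟨⟨a', b'⟩, hf⟩ hef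
    obtain ⟨h1, h2⟩ := Sigma.mk.inj_iff.mp hef
    obtain rfl : a = a' := h1
    have := (σ a).injective (eq_of_heq h2)
    obtain rfl : b = b' := congrArg Subtype.val this
    rfl
  have hsnd : ∀ e f, (lift e).2 = (lift f).2 → e = f := by
    rintro ⟨⟨a, b⟩, he⟩ ⟨⟨a', b'⟩, hf⟩ hef
    obtain ⟨h1, h2⟩ := Sigma.mk.inj_iff.mp hef
    obtain rfl : b = b' := h1
    have := (τ b).injective (eq_of_heq h2)
    obtain rfl : a = a' := congrArg Subtype.val this
    rfl
  have hmem : ∀ x, x ∈ Finset.univ.image lift ↔ ∃ e, lift e = x := fun x => by simp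
  refine ⟨Finset.univ.image lift, ⟨?_, ?_, ?_⟩, ?_, ?_, ?_⟩
  · intro x hx
    obtain ⟨e, rfl⟩ := (hmem x).mp hx
    exact e.2
  · intro x hx y hy hxy
    obtain ⟨e, rfl⟩ := (hmem x).mp hx
    obtain ⟨f, rfl⟩ := (hmem y).mp hy
    exact congrArg lift (Subtype.ext hxy)
  · intro e he
    exact ⟨lift ⟨e, he⟩, (hmem _).mpr ⟨_, rfl⟩, rfl⟩
  · intro x hx
    obtain ⟨e, rfl⟩ := (hmem x).mp hx
    exact mem_clone_E.mpr (hM.1 e.2)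
  · intro a
    refine Finset.card_le_one.mpr fun b hb b' hb' => ?_
    obtain ⟨e, he⟩ := (hmem _).mp (mem_partnersA.mp hb)
    obtain ⟨f, hf⟩ := (hmem _).mp (mem_partnersA.mp hb')
    have := hfst e f (by rw [he, hf])
    subst this
    exact (Prod.ext_iff.mp (he.symm.trans hf)).2
  · intro b
    refine Finset.card_le_one.mpr fun a ha a' ha' => ?_
    obtain ⟨e, he⟩ := (hmem _).mp (mem_partnersB.mp ha)
    obtain ⟨f, hf⟩ := (hmem _).mp (mem_partnersB.mp ha')
    have := hsnd e f (by rw [he, hf])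
    subst this
    exact (Prod.ext_iff.mp (he.symm.trans hf)).1

end MatchingInstance

theorem theorem2 {A B : Type*} [Fintype A] [Fintype B] [DecidableEq A] [DecidableEq B]
    (G : MatchingInstance A B) (M : Finset (A × B)) (hM : G.IsPerfectMatching M) :
    G.IsPopularPerfectMatching M ↔
      ∃ M' : Finset (G.CloneA × G.CloneB), G.IsRealization M M' ∧
        ¬ ∃ C : (G.cloneSub M M').AlternatingCycle M', 0 < C.weight := by
  constructor
  · intro hpop
    obtain ⟨M', hM'⟩ := MatchingInstance.exists_isRealization hM.1
    refine ⟨M', hM', ?_⟩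
    rintro ⟨C, hC⟩
    obtain ⟨π, hπ, hpos⟩ := hM'.exists_isRotation hC
    obtain ⟨N, hN, hlt⟩ := hπ.exists_Delta_neg hM hpos
    exact absurd (hpop.2 N hN) hlt.not_ge
  · rintro ⟨M', hM', hno⟩
    refine ⟨hM, fun N hN => ?_⟩
    by_contra hlt
    obtain ⟨π, hπ, hpos⟩ :=
      MatchingInstance.exists_isRotation_of_Delta_neg hM hN (not_le.mp hlt)
    exact hno (hM'.exists_alternatingCycle hπ hpos)
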